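/- Let $\mathbf{pInj}$ be the category of sets and partial injections, with $\uplus$ the disjoint union, $0$ the nowhere-defined partial injection and $\ddagger$ the relational converse. The category $\mathbf{Int}(\mathbf{pInj})$ has as objects pairs $(X,U)$ of sets. An arrow $f:(X,U)\to(Y,V)$ is a partial injection $X\uplus V\to Y\uplus U$, equivalently a rook square with edges $f_{00}:X\to Y$, $f_{01}:V\to Y$, $f_{10}:X\to U$, $f_{11}:V\to U$. The composite of $f:(X,U)\to(Y,V)$ and $g:(Y,V)\to(Z,W)$ is obtained by gluing the two squares along the edge shared by $Y$ and $V$ and taking the union over all finite paths with given source and target (for example $(gf)_{00}=\bigcup_{j\ge 0} g_{00}(f_{01}g_{10})^jf_{00}$); identities are identity maps. It is a symmetric monoidal category with $(X,U)\,\Box\,(X',U')=(X\uplus X',U'\uplus U)$, with arrows acting side by side, and unit $(\emptyset,\emptyset)$. It is compact closed, with dual $(X,U)^*=(U,X)$ on objects and the half-turn of the rook square on arrows, and hence monoidal closed, with internal hom $[A\to B]=A^*\,\Box\,B$. Let $\vartriangleleft:\mathbb N\uplus\mathbb N\to\mathbb N$ be the Cantor pairing, that is, the bijection $\vartriangleleft(n,i)=2n+i$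 for $i\in\{0,1\}$, and let $\vartriangleright:\mathbb N\to\mathbb N\uplus\mathbb N$ be its inverse. Then: 1. $(\mathbb N,\mathbb N)$ is strictly self-dual: $(\mathbb N,\mathbb N)^*=(\mathbb N,\mathbb N)$. 2. $(\mathbb N,\mathbb N)$ is self-similar: $(\mathbb N,\mathbb N)\cong(\mathbb N,\mathbb N)\,\Box\,(\mathbb N,\mathbb N)$ in $\mathbf{Int}(\mathbf{pInj})$. Explicitly, mutually inverse code and decode arrows are given by the arrow $c:(\mathbb N,\mathbb N)\,\Box\,(\mathbb N,\mathbb N)\to(\mathbb N,\mathbb N)$ with rook square $c_{00}=\vartriangleleft$, $c_{01}=0$, $c_{10}=0$, $c_{11}=\vartriangleright$, and the arrow $d:(\mathbb N,\mathbb N)\to(\mathbb N,\mathbb N)\,\Box\,(\mathbb N,\mathbb N)$ with rook square $d_{00}=\vartriangleright$, $d_{01}=0$, $d_{10}=0$, $d_{11}=\vartriangleleft$. 3. Hence $(\mathbb N,\mathbb N)$ is extensionally reflexive, i.e. isomorphic to its own internal hom: $[(\mathbb N,\mathbb N)\to(\mathbb N,\mathbb N)]\cong(\mathbb N,\mathbb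 N)$. -/

import Mathlib

open CategoryTheory MonoidalCategory

universe u

/-- A partial injection from `X` to `Y`: a relation that is single-valued and whose converse is
single-valued.  These are the arrows `X → Y` of the category `pInj`. -/
@[ext]
structure PInj (X Y : Type u) where
  rel : X → Y → Prop
  func : ∀ {x : X} {y y' : Y}, rel x y → rel x y' → y = y'
  inj : ∀ {x x' : X} {y : Y}, rel x y → rel x' y → x = x'

namespace PInj

/-- The nowhere-defined partial injection. -/
def zero (X Y : Type u) : PInj X Y where
  rel _ _ := False
  func h := h.elim
  inj h := h.elim

/-- A bijection, as a (total and surjective) partial injection. -/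
def ofEquiv {X Y : Type u} (e : X ≃ Y) : PInj X Y where
  rel x y := e x = y
  func h h' := h.symm.trans h'
  inj h h' := e.injective (h.trans h'.symm)

/-- The generalised inverse (relational converse) of a partial injection. -/
def converse {X Y : Type u} (f : PInj X Y) : PInj Y X where
  rel y x := f.rel x y
  func h h' := f.inj h h'
  inj h h' := f.func h h'

/-- The disjoint union of two partial injections. -/
def sum {X Y X' Y' : Type u} (f : PInj X Y) (g : PInj X' Y') : PInj (X ⊕ X') (Y ⊕ Y') where
  rel := Sum.LiftRel f.rel g.rel
  func := by
    rintro _ _ _ (h | h) (h' | h')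
    · exact congrArg _ (f.func h h')
    · exact congrArg _ (g.func h h')
  inj := by
    rintro _ _ _ (h | h) (h' | h')
    · exact congrArg _ (f.inj h h')
    · exact congrArg _ (g.inj h h')

/-- Conjugation of a partial injection by bijections of its source and of its target. -/
def relabel {X Y X' Y' : Type u} (a : X' ≃ X) (b : Y' ≃ Y) (f : PInj X Y) : PInj X' Y' where
  rel x y := f.rel (a x) (b y)
  func h h' := b.injective (f.func h h')
  inj h h' := a.injective (f.inj h h')

theorem rel_ext {X Y : Type u} {f g : PInj X Y} (h : ∀ x y, f.rel x y ↔ g.rel x y) : f = g := by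
  ext x y; exact h x y

/-- A bijection that is contained in a partial injection is equal to it. -/
theorem eq_ofEquiv {X Y : Type u} {f : PInj X Y} (e : X ≃ Y) (h : ∀ x, f.rel x (e x)) :
    f = ofEquiv e :=
  rel_ext fun x _ => ⟨fun h' => f.func (h x) h', fun h' => h' ▸ h x⟩

end PInj

/-- An object of `Int(pInj)`: a pair `(pos, neg)` of sets. -/
@[ext]
structure IntPInj : Type (u + 1) where
  pos : Type u
  neg : Type u

namespace IntPInj

/-! ### Composition -/

section Run

variable {X U Y V Z W S T : Type u}

/-- Paths in the graph obtained by gluing the squares `f : (X,U) → (Y,V)` and `g : (Y,V) → (Z,W)`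
along their common edge between `Y` and `V`.  `Run f g s o` says that there is a finite path that
begins at `s`, which is an input wire of `f` (left summand) or an input wire of `g` (right summand),
and ends at `o`, an output wire of the glued square; the path is made of alternating steps of `f`
and `g` through the shared wires `Y` (from `f` to `g`) and `V` (from `g` to `f`). -/
inductive Run (f : X ⊕ V → Y ⊕ U → Prop) (g : Y ⊕ W → Z ⊕ V → Prop) :
    (X ⊕ V) ⊕ (Y ⊕ W) → Z ⊕ U → Prop
  | f_exit {a : X ⊕ V} {u : U} : f a (.inr u) → Run f g (.inl a) (.inr u)
  | f_next {a : X ⊕ V} {y : Y} {o : Z ⊕ U} :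
      f a (.inl y) → Run f g (.inr (.inl y)) o → Run f g (.inl a) o
  | g_exit {b : Y ⊕ W} {z : Z} : g b (.inl z) → Run f g (.inr b) (.inl z)
  | g_next {b : Y ⊕ W} {v : V} {o : Z ⊕ U} :
      g b (.inr v) → Run f g (.inl (.inr v)) o → Run f g (.inr b) o

/-- The union over all paths from an input wire in `X` or `W` to an output wire in `Z` or `U`. -/
def compRel (f : X ⊕ V → Y ⊕ U → Prop) (g : Y ⊕ W → Z ⊕ V → Prop) : X ⊕ W → Z ⊕ U → Prop :=
  fun p o => Run f g (Sum.map .inl .inr p) o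

theorem Run.det {f : X ⊕ V → Y ⊕ U → Prop} {g : Y ⊕ W → Z ⊕ V → Prop}
    (hf : ∀ a b b', f a b → f a b' → b = b') (hg : ∀ a b b', g a b → g a b' → b = b')
    {s o o'} (h : Run f g s o) (h' : Run f g s o') : o = o' := by
  induction h with
  | f_exit h1 =>
    cases h' with
    | f_exit h2 => simpa using hf _ _ _ h1 h2
    | f_next h2 _ => simpa using hf _ _ _ h1 h2
  | f_next h1 _ ih =>
    cases h' with
    | f_exit h2 => simpa using hf _ _ _ h1 h2
    | f_next h2 h3 => obtain rfl : _ = _ := by simpa using hf _ _ _ h1 h2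
                      exact ih h3
  | g_exit h1 =>
    cases h' with
    | g_exit h2 => simpa using hg _ _ _ h1 h2
    | g_next h2 _ => simpa using hg _ _ _ h1 h2
  | g_next h1 _ ih =>
    cases h' with
    | g_exit h2 => simpa using hg _ _ _ h1 h2
    | g_next h2 h3 => obtain rfl : _ = _ := by simpa using hg _ _ _ h1 h2
                      exact ih h3

theorem compRel_flip_of {f : X ⊕ V → Y ⊕ U → Prop} {g : Y ⊕ W → Z ⊕ V → Prop} {p o}
    (h : compRel f g p o) : compRel (flip g) (flip f) o p := by
  have key : ∀ {s o}, Run f g s o → ∀ i : X ⊕ W,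
      (match s with
        | .inl (.inl x) => i = .inl x
        | .inl (.inr v) => Run (flip g) (flip f) (.inl (.inr v)) i
        | .inr (.inl y) => Run (flip g) (flip f) (.inr (.inl y)) i
        | .inr (.inr w) => i = .inr w) →
      Run (flip g) (flip f) (Sum.map .inl .inr o) i := by
    intro s o h
    induction h with
    | @f_exit a u h =>
      intro i hi
      rcases a with x | v
      · obtain rfl := hi
        exact .g_exit h
      · exact .g_next h hi
    | @f_next a y o h _ ih =>
      intro i hi
      refine ih i ?_
      rcases a with x | v
      · obtain rfl := hi
        exact .g_exit h
      · exact .g_next h hi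
    | @g_exit b z h =>
      intro i hi
      rcases b with y | w
      · exact .f_next h hi
      · obtain rfl := hi
        exact .f_exit h
    | @g_next b v o h _ ih =>
      intro i hi
      refine ih i ?_
      rcases b with y | w
      · exact .f_next h hi
      · obtain rfl := hi
        exact .f_exit h
  refine key h p ?_
  rcases p with x | w <;> rfl

theorem compRel_assoc_of {f : X ⊕ V → Y ⊕ U → Prop} {g : Y ⊕ W → Z ⊕ V → Prop}
    {h : Z ⊕ T → S ⊕ W → Prop} {p o} (H : compRel (compRel f g) h p o) :
    compRel f (compRel g h) p o := by
  let cont : S ⊕ V → S ⊕ U → Prop := fun q o =>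
    match q with
    | .inl s => o = .inl s
    | .inr v => Run f (compRel g h) (.inl (.inr v)) o
  let Good : (X ⊕ V) ⊕ ((Y ⊕ W) ⊕ (Z ⊕ T)) → S ⊕ U → Prop := fun s o =>
    match s with
    | .inl a => Run f (compRel g h) (.inl a) o
    | .inr (.inl b) => ∃ q, Run g h (.inl b) q ∧ cont q o
    | .inr (.inr c) => ∃ q, Run g h (.inr c) q ∧ cont q o
  have f1 : ∀ {a u}, f a (.inr u) → Good (.inl a) (.inr u) := fun h => .f_exit h
  have f2 : ∀ {a y o}, f a (.inl y) → Good (.inr (.inl (.inl y))) o → Good (.inl a) o := by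
    rintro a y o h1 ⟨q | v, h2, h3⟩
    · obtain rfl := h3
      exact .f_next h1 (.g_exit h2)
    · exact .f_next h1 (.g_next h2 h3)
  have g1 : ∀ {b z o}, g b (.inl z) → Good (.inr (.inr (.inl z))) o → Good (.inr (.inl b)) o := by
    rintro b z o h1 ⟨q, h2, h3⟩
    exact ⟨q, .f_next h1 h2, h3⟩
  have g2 : ∀ {b v o}, g b (.inr v) → Good (.inl (.inr v)) o → Good (.inr (.inl b)) o :=
    fun {b v o} h1 h2 => ⟨.inr v, .f_exit h1, h2⟩
  have h1 : ∀ {c s}, h c (.inl s) → Good (.inr (.inr c)) (.inl s) :=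
    fun {c s} h1 => ⟨.inl s, .g_exit h1, rfl⟩
  have h2 : ∀ {c w o}, h c (.inr w) → Good (.inr (.inl (.inr w))) o → Good (.inr (.inr c)) o := by
    rintro c w o h1 ⟨q, h2, h3⟩
    exact ⟨q, .g_next h1 h2, h3⟩
  let contL : Z ⊕ U → S ⊕ U → Prop := fun q o =>
    match q with
    | .inl z => Good (.inr (.inr (.inl z))) o
    | .inr u => o = .inr u
  have inner : ∀ {r q}, Run f g r q → ∀ o, contL q o → Good (Sum.map id .inl r) o := by
    intro r q hr
    induction hr with
    | f_exit h => intro o ho; obtain rfl := ho; exact f1 h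
    | f_next h _ ih => intro o ho; exact f2 h (ih o ho)
    | g_exit h => intro o ho; exact g1 h ho
    | g_next h _ ih => intro o ho; exact g2 h (ih o ho)
  have outer : ∀ {r o}, Run (compRel f g) h r o →
      (match r with
        | .inl p => Good (Sum.map id .inl (Sum.map (Sum.inl : X → X ⊕ V) (Sum.inr : W → Y ⊕ W) p)) o
        | .inr c => Good (.inr (.inr c)) o) := by
    intro r o hr
    induction hr with
    | f_exit h => exact inner h _ rfl
    | f_next h _ ih => exact inner h _ ih
    | g_exit h => exact h1 h
    | g_next h _ ih => exact h2 h ih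
  rcases p with x | t
  · exact outer H
  · obtain ⟨q | v, h3, h4⟩ := outer H
    · obtain rfl := h4
      exact .g_exit h3
    · exact .g_next h3 h4

theorem compRel_flip (f : X ⊕ V → Y ⊕ U → Prop) (g : Y ⊕ W → Z ⊕ V → Prop) :
    flip (compRel f g) = compRel (flip g) (flip f) := by
  ext o p
  exact ⟨compRel_flip_of, fun h => compRel_flip_of h⟩

theorem compRel_assoc (f : X ⊕ V → Y ⊕ U → Prop) (g : Y ⊕ W → Z ⊕ V → Prop)
    (h : Z ⊕ T → S ⊕ W → Prop) :
    compRel (compRel f g) h = compRel f (compRel g h) := by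
  ext p o
  refine ⟨compRel_assoc_of, fun H => ?_⟩
  have H' := compRel_flip_of H
  rw [compRel_flip] at H'
  have H'' := compRel_flip_of (compRel_assoc_of H')
  rw [compRel_flip] at H''
  exact H''

/-- The dual of a relation: both the rows and the columns of its matrix are exchanged. -/
def dualRel (f : X ⊕ V → Y ⊕ U → Prop) : V ⊕ X → U ⊕ Y → Prop := fun p o => f p.swap o.swap

theorem compRel_dual_of {f : X ⊕ V → Y ⊕ U → Prop} {g : Y ⊕ W → Z ⊕ V → Prop} {p o}
    (h : compRel f g p o) : compRel (dualRel g) (dualRel f) p.swap o.swap := by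
  have key : ∀ {s o}, Run f g s o →
      Run (dualRel g) (dualRel f) (Sum.map Sum.swap Sum.swap s).swap o.swap := by
    intro s o h
    induction h with
    | f_exit h => exact .g_exit (by simpa [dualRel] using h)
    | @f_next a y o h _ ih => exact .g_next (v := y) (by simpa [dualRel] using h) ih
    | g_exit h => exact .f_exit (by simpa [dualRel] using h)
    | @g_next b v o h _ ih => exact .f_next (y := v) (by simpa [dualRel] using h) ih
  rcases p with x | w <;> exact key h

theorem dualRel_dualRel (f : X ⊕ V → Y ⊕ U → Prop) : dualRel (dualRel f) = f := by
  ext p o; simp [dualRel]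

theorem dualRel_compRel (f : X ⊕ V → Y ⊕ U → Prop) (g : Y ⊕ W → Z ⊕ V → Prop) :
    dualRel (compRel f g) = compRel (dualRel g) (dualRel f) := by
  ext p o
  refine ⟨fun h => by simpa using compRel_dual_of h, fun h => ?_⟩
  have := compRel_dual_of h
  rwa [dualRel_dualRel, dualRel_dualRel] at this

end Run

/-! ### The category `Int(pInj)` -/

/-- The composite in `Int(pInj)` of `f : (X,U) → (Y,V)` and `g : (Y,V) → (Z,W)`. -/
def comp {A B C : IntPInj.{u}} (f : PInj (A.pos ⊕ B.neg) (B.pos ⊕ A.neg))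
    (g : PInj (B.pos ⊕ C.neg) (C.pos ⊕ B.neg)) : PInj (A.pos ⊕ C.neg) (C.pos ⊕ A.neg) where
  rel := compRel f.rel g.rel
  func h h' := Run.det (f := f.rel) (g := g.rel) (fun _ _ _ => f.func) (fun _ _ _ => g.func) h h'
  inj h h' := Run.det (f := flip g.rel) (g := flip f.rel) (fun _ _ _ => g.inj)
    (fun _ _ _ => f.inj) (compRel_flip_of h) (compRel_flip_of h')

theorem id_comp_rel {X U Y V : Type u} (f : X ⊕ V → Y ⊕ U → Prop) :
    compRel (fun a b : X ⊕ U => a = b) f = f := by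
  ext p o
  constructor
  · intro h
    have key : ∀ {s o}, Run (fun a b : X ⊕ U => a = b) f s o →
        (match s with
          | .inl (.inl x) => f (.inl x) o
          | .inl (.inr u) => o = .inr u
          | .inr b => f b o) := by
      intro s o h
      induction h with
      | f_exit h => subst h; rfl
      | f_next h _ ih => subst h; exact ih
      | g_exit h => exact h
      | g_next h _ ih => simp only at ih; subst ih; exact h
    rcases p with x | v <;> exact key h
  · intro h
    have : Run (fun a b : X ⊕ U => a = b) f (.inr p) o := by
      rcases o with y | u
      · exact .g_exit h
      · exact .g_next h (.f_exit rfl)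
    rcases p with x | v
    · exact .f_next rfl this
    · exact this

theorem comp_id_rel {X U Y V : Type u} (f : X ⊕ V → Y ⊕ U → Prop) :
    compRel f (fun a b : Y ⊕ V => a = b) = f := by
  have h := id_comp_rel (flip f)
  have h' := congrArg flip h
  rw [compRel_flip] at h'
  have e : flip (fun a b : Y ⊕ V => a = b) = fun a b => a = b := by
    ext a b; exact eq_comm
  rw [e] at h'
  exact h'

/-- The category `Int(pInj)`: arrows `(X,U) → (Y,V)` are the partial injections
`X ⊎ V → Y ⊎ U`, the identities are identity maps and composition is the union over all paths. -/
instance : Category IntPInj.{u} where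
  Hom A B := PInj (A.pos ⊕ B.neg) (B.pos ⊕ A.neg)
  id A := PInj.ofEquiv (Equiv.refl (A.pos ⊕ A.neg))
  comp f g := comp f g
  id_comp f := PInj.ext (id_comp_rel f.rel)
  comp_id f := PInj.ext (comp_id_rel f.rel)
  assoc f g h := PInj.ext (compRel_assoc f.rel g.rel h.rel)

/-- The partial injection `X ⊎ V → Y ⊎ U` underlying an arrow `(X,U) → (Y,V)`. -/
def toPInj {A B : IntPInj.{u}} (f : A ⟶ B) : PInj (A.pos ⊕ B.neg) (B.pos ⊕ A.neg) := f

/-- The arrow `(X,U) → (Y,V)` given by a partial injection `X ⊎ V → Y ⊎ U`. -/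
def ofPInj {A B : IntPInj.{u}} (f : PInj (A.pos ⊕ B.neg) (B.pos ⊕ A.neg)) : A ⟶ B := f

@[simp] theorem toPInj_ofPInj {A B : IntPInj.{u}}
    (f : PInj (A.pos ⊕ B.neg) (B.pos ⊕ A.neg)) : toPInj (ofPInj f : A ⟶ B) = f := rfl

theorem hom_ext {A B : IntPInj.{u}} {f g : A ⟶ B}
    (h : ∀ p q, (toPInj f).rel p q ↔ (toPInj g).rel p q) : f = g :=
  PInj.rel_ext h

theorem comp_rel {A B C : IntPInj.{u}} (f : A ⟶ B) (g : B ⟶ C) :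
    (toPInj (f ≫ g)).rel = compRel (toPInj f).rel (toPInj g).rel := rfl

/-- The `X → Y` edge of the rook square of an arrow `(X,U) → (Y,V)`. -/
def edge00 {A B : IntPInj.{u}} (f : A ⟶ B) : PInj A.pos B.pos where
  rel x y := (toPInj f).rel (.inl x) (.inl y)
  func h h' := by simpa using (toPInj f).func h h'
  inj h h' := by simpa using (toPInj f).inj h h'

/-- The `V → Y` edge of the rook square of an arrow `(X,U) → (Y,V)`. -/
def edge01 {A B : IntPInj.{u}} (f : A ⟶ B) : PInj B.neg B.pos where
  rel v y := (toPInj f).rel (.inr v) (.inl y)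
  func h h' := by simpa using (toPInj f).func h h'
  inj h h' := by simpa using (toPInj f).inj h h'

/-- The `X → U` edge of the rook square of an arrow `(X,U) → (Y,V)`. -/
def edge10 {A B : IntPInj.{u}} (f : A ⟶ B) : PInj A.pos A.neg where
  rel x u := (toPInj f).rel (.inl x) (.inr u)
  func h h' := by simpa using (toPInj f).func h h'
  inj h h' := by simpa using (toPInj f).inj h h'

/-- The `V → U` edge of the rook square of an arrow `(X,U) → (Y,V)`. -/
def edge11 {A B : IntPInj.{u}} (f : A ⟶ B) : PInj B.neg A.neg where
  rel v u := (toPInj f).rel (.inr v) (.inr u)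
  func h h' := by simpa using (toPInj f).func h h'
  inj h h' := by simpa using (toPInj f).inj h h'

/-- The arrow `(X,U) → (Y,V)` whose rook square has the edges `X ≃ Y` and `V ≃ U` and is zero on
the two remaining edges. -/
def diag {A B : IntPInj.{u}} (a : A.pos ≃ B.pos) (b : A.neg ≃ B.neg) : A ⟶ B :=
  ofPInj (PInj.ofEquiv (Equiv.sumCongr a b.symm))

theorem id_eq_diag (A : IntPInj.{u}) : 𝟙 A = diag (Equiv.refl _) (Equiv.refl _) :=
  congrArg PInj.ofEquiv (by ext p; rcases p with _ | _ <;> rfl)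

theorem diag_comp_rel {A B C : IntPInj.{u}} (a : A.pos ≃ B.pos) (b : A.neg ≃ B.neg) (g : B ⟶ C)
    (p : A.pos ⊕ C.neg) (q : C.pos ⊕ A.neg) :
    (toPInj (diag a b ≫ g)).rel p q ↔ (toPInj g).rel (Sum.map a id p) (Sum.map id b q) := by
  rw [comp_rel]
  constructor
  · intro h
    have key : ∀ {s o}, Run (toPInj (diag a b : A ⟶ B)).rel (toPInj g).rel s o →
        (match s with
          | .inl (.inl x) => (toPInj g).rel (.inl (a x)) (Sum.map id b o)
          | .inl (.inr v) => Sum.map id b o = .inr v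
          | .inr c => (toPInj g).rel c (Sum.map id b o)) := by
      intro s o h
      induction h with
      | @f_exit c u h =>
        rcases c with x | v
        · exact absurd h (by simp [diag, PInj.ofEquiv])
        · obtain rfl : b.symm v = u := by simpa [diag, PInj.ofEquiv] using h
          simp
      | @f_next c y o h _ ih =>
        rcases c with x | v
        · obtain rfl : a x = y := by simpa [diag, PInj.ofEquiv] using h
          exact ih
        · exact absurd h (by simp [diag, PInj.ofEquiv])
      | g_exit h => exact h
      | g_next h _ ih => simp only at ih; rw [ih]; exact h
    rcases p with x | v <;> exact key h
  · intro h
    have : Run (toPInj (diag a b : A ⟶ B)).rel (toPInj g).rel (.inr (Sum.map a id p)) q := by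
      rcases q with y | u
      · exact .g_exit h
      · exact .g_next h (.f_exit (by simp [diag, PInj.ofEquiv]))
    rcases p with x | v
    · exact .f_next (by simp [diag, PInj.ofEquiv]) this
    · exact this

theorem comp_diag_rel {A B C : IntPInj.{u}} (f : A ⟶ B) (a : B.pos ≃ C.pos) (b : B.neg ≃ C.neg)
    (p : A.pos ⊕ C.neg) (q : C.pos ⊕ A.neg) :
    (toPInj (f ≫ diag a b)).rel p q ↔
      (toPInj f).rel (Sum.map id b.symm p) (Sum.map a.symm id q) := by
  have h := diag_comp_rel (A := C) (B := B) (C := A) a.symm b.symm (toPInj f).converse q p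
  rw [comp_rel] at h ⊢
  have e : (toPInj (diag a.symm b.symm : C ⟶ B)).rel = flip (toPInj (diag a b : B ⟶ C)).rel := by
    ext c d
    rcases c with c | c <;> rcases d with d | d <;> simp only [diag, PInj.ofEquiv, flip]
    · simpa [Equiv.symm_apply_eq] using eq_comm
    · simp
    · simp
    · simpa [Equiv.symm_apply_eq] using eq_comm
  rw [e] at h
  change compRel (flip _) (flip (toPInj f).rel) q p ↔ _ at h
  rw [← compRel_flip] at h
  exact h

theorem diag_comp_diag {A B C : IntPInj.{u}} (a : A.pos ≃ B.pos) (b : A.neg ≃ B.neg)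
    (c : B.pos ≃ C.pos) (d : B.neg ≃ C.neg) :
    (diag a b : A ⟶ B) ≫ (diag c d : B ⟶ C) = diag (a.trans c) (b.trans d) := by
  refine hom_ext fun p q => ?_
  rw [diag_comp_rel]
  rcases p with p | p <;> rcases q with q | q <;>
    simp [diag, PInj.ofEquiv, Equiv.symm_apply_eq]

/-- The isomorphism of `Int(pInj)` given by two bijections. -/
def diagIso {A B : IntPInj.{u}} (a : A.pos ≃ B.pos) (b : A.neg ≃ B.neg) : A ≅ B where
  hom := diag a b
  inv := diag a.symm b.symm
  hom_inv_id := by simp [diag_comp_diag, id_eq_diag]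
  inv_hom_id := by simp [diag_comp_diag, id_eq_diag]

/-! ### The dual -/

/-- The dual `(X,U)* = (U,X)` of an object. -/
abbrev dual (A : IntPInj.{u}) : IntPInj.{u} := ⟨A.neg, A.pos⟩

/-- The dual of an arrow: the rook square is rotated by a half turn. -/
def dualHom {A B : IntPInj.{u}} (f : A ⟶ B) : dual B ⟶ dual A :=
  ofPInj ((toPInj f).relabel (Equiv.sumComm _ _) (Equiv.sumComm _ _))

/-- The contravariant dual of `Int(pInj)`. -/
def dualFunctor : IntPInj.{u}ᵒᵖ ⥤ IntPInj.{u} where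
  obj A := dual A.unop
  map f := dualHom f.unop
  map_id A := by
    refine PInj.eq_ofEquiv _ fun p => ?_
    rcases p with p | p <;> rfl
  map_comp f g := PInj.ext (dualRel_compRel (toPInj g.unop).rel (toPInj f.unop).rel)

/-! ### The tensor -/

/-- The rearrangement of wires used by the tensor. -/
def shuffle (X X' V V' : Type u) : (X ⊕ X') ⊕ (V' ⊕ V) ≃ (X ⊕ V) ⊕ (X' ⊕ V') where
  toFun
    | .inl (.inl x) => .inl (.inl x)
    | .inl (.inr x) => .inr (.inl x)
    | .inr (.inl v) => .inr (.inr v)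
    | .inr (.inr v) => .inl (.inr v)
  invFun
    | .inl (.inl x) => .inl (.inl x)
    | .inr (.inl x) => .inl (.inr x)
    | .inr (.inr v) => .inr (.inl v)
    | .inl (.inr v) => .inr (.inr v)
  left_inv := by rintro ((_ | _) | (_ | _)) <;> rfl
  right_inv := by rintro ((_ | _) | (_ | _)) <;> rfl

/-- The tensor `(X,U) □ (X',U') = (X ⊎ X', U' ⊎ U)` of objects. -/
abbrev tensor (A B : IntPInj.{u}) : IntPInj.{u} := ⟨A.pos ⊕ B.pos, B.neg ⊕ A.neg⟩

/-- The tensor of arrows: the two partial injections act side by side. -/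
def tensorMap {A B A' B' : IntPInj.{u}} (f : A ⟶ B) (g : A' ⟶ B') : tensor A A' ⟶ tensor B B' :=
  ofPInj (((toPInj f).sum (toPInj g)).relabel
    (shuffle A.pos A'.pos B.neg B'.neg) (shuffle B.pos B'.pos A.neg A'.neg))

theorem tensorMap_comp {A B C A' B' C' : IntPInj.{u}} (f : A ⟶ B) (f' : A' ⟶ B') (g : B ⟶ C)
    (g' : B' ⟶ C') :
    tensorMap f f' ≫ tensorMap g g' = tensorMap (f ≫ g) (f' ≫ g') := by
  let F := (toPInj (tensorMap f f')).rel
  let G := (toPInj (tensorMap g g')).rel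
  refine hom_ext fun p q => ?_
  constructor
  · intro h
    have key : ∀ {s o}, Run F G s o →
        Sum.LiftRel (Run (toPInj f).rel (toPInj g).rel) (Run (toPInj f').rel (toPInj g').rel)
          (match s with
            | .inl p => Sum.map .inl .inl (shuffle A.pos A'.pos B.neg B'.neg p)
            | .inr p => Sum.map .inr .inr (shuffle B.pos B'.pos C.neg C'.neg p))
          (shuffle C.pos C'.pos A.neg A'.neg o) := by
      intro s o h
      induction h with
      | @f_exit a u h =>
        change Sum.LiftRel (toPInj f).rel (toPInj f').rel _ _ at h
        dsimp only
        generalize shuffle A.pos A'.pos B.neg B'.neg a = a' at h ⊢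
        rcases u with u | u
        · rcases h with h | h
          exact .inr (.f_exit h)
        · rcases h with h | h
          exact .inl (.f_exit h)
      | @f_next a y o h _ ih =>
        change Sum.LiftRel (toPInj f).rel (toPInj f').rel _ _ at h
        dsimp only at ih ⊢
        generalize shuffle A.pos A'.pos B.neg B'.neg a = a' at h ⊢
        generalize shuffle C.pos C'.pos A.neg A'.neg o = o' at ih ⊢
        rcases y with y | y
        · rcases h with h | h
          rcases ih with ih | ih
          exact .inl (.f_next h ih)
        · rcases h with h | h
          rcases ih with ih | ih
          exact .inr (.f_next h ih)
      | @g_exit a u h =>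
        change Sum.LiftRel (toPInj g).rel (toPInj g').rel _ _ at h
        dsimp only
        generalize shuffle B.pos B'.pos C.neg C'.neg a = a' at h ⊢
        rcases u with u | u
        · rcases h with h | h
          exact .inl (.g_exit h)
        · rcases h with h | h
          exact .inr (.g_exit h)
      | @g_next a y o h _ ih =>
        change Sum.LiftRel (toPInj g).rel (toPInj g').rel _ _ at h
        dsimp only at ih ⊢
        generalize shuffle B.pos B'.pos C.neg C'.neg a = a' at h ⊢
        generalize shuffle C.pos C'.pos A.neg A'.neg o = o' at ih ⊢
        rcases y with y | y
        · rcases h with h | h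
          rcases ih with ih | ih
          exact .inr (.g_next h ih)
        · rcases h with h | h
          rcases ih with ih | ih
          exact .inl (.g_next h ih)
    have := key h
    change Sum.LiftRel (toPInj (f ≫ g)).rel (toPInj (f' ≫ g')).rel
      (shuffle A.pos A'.pos C.neg C'.neg p) (shuffle C.pos C'.pos A.neg A'.neg q)
    generalize shuffle C.pos C'.pos A.neg A'.neg q = o at this ⊢
    rcases p with (p | p) | (p | p) <;> rcases this with h | h
    · exact .inl h
    · exact .inr h
    · exact .inr h
    · exact .inl h
  · intro h
    change Sum.LiftRel (toPInj (f ≫ g)).rel (toPInj (f' ≫ g')).rel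
      (shuffle A.pos A'.pos C.neg C'.neg p) (shuffle C.pos C'.pos A.neg A'.neg q) at h
    have key1 : ∀ {s o}, Run (toPInj f).rel (toPInj g).rel s o →
        Run F G (Sum.map (fun a => (shuffle A.pos A'.pos B.neg B'.neg).symm (.inl a))
          (fun a => (shuffle B.pos B'.pos C.neg C'.neg).symm (.inl a)) s)
          ((shuffle C.pos C'.pos A.neg A'.neg).symm (.inl o)) := by
      have hF : ∀ {a b}, (toPInj f).rel a b →
          F ((shuffle A.pos A'.pos B.neg B'.neg).symm (.inl a))
            ((shuffle B.pos B'.pos A.neg A'.neg).symm (.inl b)) := by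
        intro a b h
        change Sum.LiftRel (toPInj f).rel (toPInj f').rel (shuffle _ _ _ _ _) (shuffle _ _ _ _ _)
        rw [Equiv.apply_symm_apply, Equiv.apply_symm_apply]
        exact .inl h
      have hG : ∀ {a b}, (toPInj g).rel a b →
          G ((shuffle B.pos B'.pos C.neg C'.neg).symm (.inl a))
            ((shuffle C.pos C'.pos B.neg B'.neg).symm (.inl b)) := by
        intro a b h
        change Sum.LiftRel (toPInj g).rel (toPInj g').rel (shuffle _ _ _ _ _) (shuffle _ _ _ _ _)
        rw [Equiv.apply_symm_apply, Equiv.apply_symm_apply]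
        exact .inl h
      intro s o h
      induction h with
      | f_exit h => exact .f_exit (hF h)
      | f_next h _ ih => exact .f_next (hF h) ih
      | g_exit h => exact .g_exit (hG h)
      | g_next h _ ih => exact .g_next (hG h) ih
    have key2 : ∀ {s o}, Run (toPInj f').rel (toPInj g').rel s o →
        Run F G (Sum.map (fun a => (shuffle A.pos A'.pos B.neg B'.neg).symm (.inr a))
          (fun a => (shuffle B.pos B'.pos C.neg C'.neg).symm (.inr a)) s)
          ((shuffle C.pos C'.pos A.neg A'.neg).symm (.inr o)) := by
      have hF : ∀ {a b}, (toPInj f').rel a b →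
          F ((shuffle A.pos A'.pos B.neg B'.neg).symm (.inr a))
            ((shuffle B.pos B'.pos A.neg A'.neg).symm (.inr b)) := by
        intro a b h
        change Sum.LiftRel (toPInj f).rel (toPInj f').rel (shuffle _ _ _ _ _) (shuffle _ _ _ _ _)
        rw [Equiv.apply_symm_apply, Equiv.apply_symm_apply]
        exact .inr h
      have hG : ∀ {a b}, (toPInj g').rel a b →
          G ((shuffle B.pos B'.pos C.neg C'.neg).symm (.inr a))
            ((shuffle C.pos C'.pos B.neg B'.neg).symm (.inr b)) := by
        intro a b h
        change Sum.LiftRel (toPInj g).rel (toPInj g').rel (shuffle _ _ _ _ _) (shuffle _ _ _ _ _)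
        rw [Equiv.apply_symm_apply, Equiv.apply_symm_apply]
        exact .inr h
      intro s o h
      induction h with
      | f_exit h => exact .f_exit (hF h)
      | f_next h _ ih => exact .f_next (hF h) ih
      | g_exit h => exact .g_exit (hG h)
      | g_next h _ ih => exact .g_next (hG h) ih
    obtain ⟨q, rfl⟩ := (shuffle C.pos C'.pos A.neg A'.neg).symm.surjective q
    rw [Equiv.apply_symm_apply] at h
    rcases p with (p | p) | (p | p) <;> rcases h with h | h
    · exact key1 h
    · exact key2 h
    · exact key2 h
    · exact key1 h

theorem tensorMap_diag {A B A' B' : IntPInj.{u}} (a : A.pos ≃ B.pos) (b : A.neg ≃ B.neg)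
    (a' : A'.pos ≃ B'.pos) (b' : A'.neg ≃ B'.neg) :
    tensorMap (diag a b : A ⟶ B) (diag a' b' : A' ⟶ B') =
      diag (Equiv.sumCongr a a') (Equiv.sumCongr b' b) := by
  refine PInj.eq_ofEquiv _ fun p => ?_
  rcases p with (p | p) | (p | p)
  · exact .inl rfl
  · exact .inr rfl
  · exact .inr rfl
  · exact .inl rfl

theorem tensorMap_rel {A B A' B' : IntPInj.{u}} (f : A ⟶ B) (g : A' ⟶ B') (p q) :
    (toPInj (tensorMap f g)).rel p q ↔ Sum.LiftRel (toPInj f).rel (toPInj g).rel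
      (shuffle A.pos A'.pos B.neg B'.neg p) (shuffle B.pos B'.pos A.neg A'.neg q) := Iff.rfl

/-- The unit object `(∅, ∅)`. -/
abbrev unit : IntPInj.{u} := ⟨PEmpty, PEmpty⟩

/-- The associator. -/
def assocIso (A B C : IntPInj.{u}) : tensor (tensor A B) C ≅ tensor A (tensor B C) :=
  diagIso (Equiv.sumAssoc A.pos B.pos C.pos) (Equiv.sumAssoc C.neg B.neg A.neg).symm

/-- The left unitor. -/
def leftIso (A : IntPInj.{u}) : tensor unit A ≅ A :=
  diagIso (Equiv.emptySum PEmpty A.pos) (Equiv.sumEmpty A.neg PEmpty)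

/-- The right unitor. -/
def rightIso (A : IntPInj.{u}) : tensor A unit ≅ A :=
  diagIso (Equiv.sumEmpty A.pos PEmpty) (Equiv.emptySum PEmpty A.neg)

/-- The symmetry. -/
def symmIso (A B : IntPInj.{u}) : tensor A B ≅ tensor B A :=
  diagIso (Equiv.sumComm A.pos B.pos) (Equiv.sumComm B.neg A.neg)

theorem diag_congr {A B : IntPInj.{u}} {a a' : A.pos ≃ B.pos} {b b' : A.neg ≃ B.neg}
    (h : ∀ x, a x = a' x) (h' : ∀ x, b x = b' x) : diag a b = diag a' b' := by
  rw [Equiv.ext h, Equiv.ext h']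

theorem tensorMap_id (A B : IntPInj.{u}) : tensorMap (𝟙 A) (𝟙 B) = 𝟙 (tensor A B) := by
  rw [id_eq_diag, id_eq_diag, id_eq_diag, tensorMap_diag]
  refine diag_congr ?_ ?_ <;> rintro (_ | _) <;> rfl

theorem assoc_natural {A B C A' B' C' : IntPInj.{u}} (f : A ⟶ A') (g : B ⟶ B') (h : C ⟶ C') :
    tensorMap (tensorMap f g) h ≫ (assocIso A' B' C').hom =
      (assocIso A B C).hom ≫ tensorMap f (tensorMap g h) := by
  refine hom_ext fun p q => (comp_diag_rel _ _ _ _ _).trans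
    (Iff.trans ?_ (diag_comp_rel _ _ _ _ _).symm)
  rcases p with ((p | p) | p) | ((p | p) | p) <;> rcases q with (q | q | q) | (q | q | q) <;>
    simp [tensorMap_rel, shuffle]

theorem left_natural {A B : IntPInj.{u}} (f : A ⟶ B) :
    tensorMap (𝟙 unit) f ≫ (leftIso B).hom = (leftIso A).hom ≫ f := by
  refine hom_ext fun p q => (comp_diag_rel _ _ _ _ _).trans
    (Iff.trans ?_ (diag_comp_rel _ _ _ _ _).symm)
  rcases p with (p | p) | p <;> rcases q with q | (q | q) <;>
    first | exact p.elim | exact q.elim | simp [tensorMap_rel, shuffle]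

theorem right_natural {A B : IntPInj.{u}} (f : A ⟶ B) :
    tensorMap f (𝟙 unit) ≫ (rightIso B).hom = (rightIso A).hom ≫ f := by
  refine hom_ext fun p q => (comp_diag_rel _ _ _ _ _).trans
    (Iff.trans ?_ (diag_comp_rel _ _ _ _ _).symm)
  rcases p with (p | p) | p <;> rcases q with q | (q | q) <;>
    first | exact p.elim | exact q.elim | simp [tensorMap_rel, shuffle]

theorem symm_natural {A B A' B' : IntPInj.{u}} (f : A ⟶ A') (g : B ⟶ B') :
    tensorMap f g ≫ (symmIso A' B').hom = (symmIso A B).hom ≫ tensorMap g f := by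
  refine hom_ext fun p q => (comp_diag_rel _ _ _ _ _).trans
    (Iff.trans ?_ (diag_comp_rel _ _ _ _ _).symm)
  rcases p with (p | p) | (p | p) <;> rcases q with (q | q) | (q | q) <;>
    simp [tensorMap_rel, shuffle]

theorem pentagon_aux (A B C D : IntPInj.{u}) :
    tensorMap (assocIso A B C).hom (𝟙 D) ≫ (assocIso A (tensor B C) D).hom ≫
        tensorMap (𝟙 A) (assocIso B C D).hom =
      (assocIso (tensor A B) C D).hom ≫ (assocIso A B (tensor C D)).hom := by
  simp only [assocIso, diagIso, id_eq_diag, tensorMap_diag, diag_comp_diag]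
  refine diag_congr ?_ ?_
  · rintro (((_ | _) | _) | _) <;> rfl
  · rintro (_ | _ | _ | _) <;> rfl

theorem triangle_aux (A B : IntPInj.{u}) :
    (assocIso A unit B).hom ≫ tensorMap (𝟙 A) (leftIso B).hom =
      tensorMap (rightIso A).hom (𝟙 B) := by
  simp only [assocIso, leftIso, rightIso, diagIso, id_eq_diag, tensorMap_diag, diag_comp_diag]
  refine diag_congr ?_ ?_
  · rintro ((_ | x) | _) <;> first | rfl | exact x.elim
  · rintro (_ | x | _) <;> first | rfl | exact x.elim

theorem hexagon_aux (A B C : IntPInj.{u}) :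
    (assocIso A B C).hom ≫ (symmIso A (tensor B C)).hom ≫ (assocIso B C A).hom =
      tensorMap (symmIso A B).hom (𝟙 C) ≫ (assocIso B A C).hom ≫
        tensorMap (𝟙 B) (symmIso A C).hom := by
  simp only [assocIso, symmIso, diagIso, id_eq_diag, tensorMap_diag, diag_comp_diag]
  refine diag_congr ?_ ?_
  · rintro ((_ | _) | _) <;> rfl
  · rintro (_ | _ | _) <;> rfl

theorem hexagon_aux' (A B C : IntPInj.{u}) :
    (assocIso A B C).inv ≫ (symmIso (tensor A B) C).hom ≫ (assocIso C A B).inv =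
      tensorMap (𝟙 A) (symmIso B C).hom ≫ (assocIso A C B).inv ≫
        tensorMap (symmIso A C).hom (𝟙 B) := by
  simp only [assocIso, symmIso, diagIso, id_eq_diag, tensorMap_diag, diag_comp_diag]
  refine diag_congr ?_ ?_
  · rintro (_ | _ | _) <;> rfl
  · rintro ((_ | _) | _) <;> rfl

theorem symm_aux (A B : IntPInj.{u}) : (symmIso A B).hom ≫ (symmIso B A).hom = 𝟙 _ := by
  simp only [symmIso, diagIso, id_eq_diag, diag_comp_diag]
  refine diag_congr ?_ ?_ <;> rintro (_ | _) <;> rfl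

/-- The tensor `□` with its unit `(∅, ∅)`; the coherence isomorphisms are given by the canonical
bijections of disjoint unions. -/
instance : MonoidalCategoryStruct IntPInj.{u} where
  tensorObj A B := tensor A B
  tensorHom f g := tensorMap f g
  whiskerLeft A _ _ f := tensorMap (𝟙 A) f
  whiskerRight f A := tensorMap f (𝟙 A)
  tensorUnit := unit
  associator := assocIso
  leftUnitor := leftIso
  rightUnitor := rightIso

instance : MonoidalCategory IntPInj.{u} := MonoidalCategory.ofTensorHom
  (id_tensorHom_id := tensorMap_id)
  (id_tensorHom := fun _ _ _ _ => rfl)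
  (tensorHom_id := fun _ _ => rfl)
  (tensorHom_comp_tensorHom := tensorMap_comp)
  (associator_naturality := assoc_natural)
  (leftUnitor_naturality := left_natural)
  (rightUnitor_naturality := right_natural)
  (pentagon := pentagon_aux)
  (triangle := triangle_aux)

instance : SymmetricCategory IntPInj.{u} where
  braiding := symmIso
  braiding_naturality_right A _ _ f := symm_natural (𝟙 A) f
  braiding_naturality_left f A := symm_natural f (𝟙 A)
  hexagon_forward := hexagon_aux
  hexagon_reverse := hexagon_aux'
  symmetry := symm_aux

/-! ### The compact closed structure -/

/-- The unit arrow `(∅,∅) → A □ A*`: its only non-zero edge is the identity `X ⊎ U → X ⊎ U`. -/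
def coev (A : IntPInj.{u}) : unit ⟶ tensor A (dual A) :=
  ofPInj (A := unit) (B := tensor A (dual A))
    (PInj.ofEquiv (Equiv.sumComm PEmpty (A.pos ⊕ A.neg)))

/-- The co-unit arrow `A* □ A → (∅,∅)`: its only non-zero edge is the identity
`U ⊎ X → U ⊎ X`. -/
def ev (A : IntPInj.{u}) : tensor (dual A) A ⟶ unit :=
  ofPInj (A := tensor (dual A) A) (B := unit)
    (PInj.ofEquiv (Equiv.sumComm (A.neg ⊕ A.pos) PEmpty))

theorem zigzag (A : IntPInj.{u}) :
    tensorMap (coev A) (𝟙 A) ≫ (assocIso A (dual A) A).hom ≫ tensorMap (𝟙 A) (ev A) =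
      (leftIso A).hom ≫ (rightIso A).inv := by
  simp only [leftIso, rightIso, diagIso, diag_comp_diag]
  refine PInj.eq_ofEquiv _ fun p => ?_
  let g := (assocIso A (dual A) A).hom ≫ tensorMap (𝟙 A) (ev A)
  have hg : ∀ {p q}, (toPInj (tensorMap (𝟙 A) (ev A))).rel
      (Sum.map (Equiv.sumAssoc A.pos A.neg A.pos) id p)
      (Sum.map id (Equiv.sumAssoc A.neg A.pos A.neg).symm q) → (toPInj g).rel p q :=
    fun h => (diag_comp_rel _ _ _ _ _).mpr h
  change Run (toPInj (tensorMap (coev A) (𝟙 A))).rel (toPInj g).rel _ _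
  rcases p with (p | x) | (p | w)
  · exact p.elim
  · refine .f_next (y := Sum.inr x) (by exact .inr rfl) ?_
    refine .g_next (v := Sum.inr (Sum.inl x)) (hg (by exact .inr rfl)) ?_
    refine .f_next (y := Sum.inl (Sum.inl x)) (by exact .inl rfl) ?_
    exact .g_exit (hg (by exact .inl rfl))
  · exact p.elim
  · refine .g_next (v := Sum.inr (Sum.inr w)) (hg (by exact .inl rfl)) ?_
    refine .f_next (y := Sum.inl (Sum.inr w)) (by exact .inl rfl) ?_
    refine .g_next (v := Sum.inl w) (hg (by exact .inr rfl)) ?_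
    exact .f_exit (by exact .inr rfl)

theorem zigzag' (A : IntPInj.{u}) :
    tensorMap (𝟙 (dual A)) (coev A) ≫ (assocIso (dual A) A (dual A)).inv ≫
      tensorMap (ev A) (𝟙 (dual A)) = (rightIso (dual A)).hom ≫ (leftIso (dual A)).inv := by
  simp only [leftIso, rightIso, diagIso, diag_comp_diag]
  refine PInj.eq_ofEquiv _ fun p => ?_
  let g := (assocIso (dual A) A (dual A)).inv ≫ tensorMap (ev A) (𝟙 (dual A))
  have hg : ∀ {p q}, (toPInj (tensorMap (ev A) (𝟙 (dual A)))).rel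
      (Sum.map (Equiv.sumAssoc A.neg A.pos A.neg).symm id p)
      (Sum.map id (Equiv.sumAssoc A.pos A.neg A.pos) q) → (toPInj g).rel p q :=
    fun h => (diag_comp_rel _ _ _ _ _).mpr h
  change Run (toPInj (tensorMap (𝟙 (dual A)) (coev A))).rel (toPInj g).rel _ _
  rcases p with (w | p) | (x | p)
  · refine .f_next (y := Sum.inl w) (by exact .inl rfl) ?_
    refine .g_next (v := Sum.inl (Sum.inr w)) (hg (by exact .inl rfl)) ?_
    refine .f_next (y := Sum.inr (Sum.inr w)) (by exact .inr rfl) ?_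
    exact .g_exit (hg (by exact .inr rfl))
  · exact p.elim
  · refine .g_next (v := Sum.inl (Sum.inl x)) (hg (by exact .inr rfl)) ?_
    refine .f_next (y := Sum.inr (Sum.inl x)) (by exact .inr rfl) ?_
    refine .g_next (v := Sum.inr x) (hg (by exact .inl rfl)) ?_
    exact .f_exit (by exact .inl rfl)
  · exact p.elim

/-- `A` and `A*` are dual objects. -/
instance exactPairing (A : IntPInj.{u}) : ExactPairing A (dual A) where
  coevaluation' := coev A
  evaluation' := ev A
  coevaluation_evaluation' := zigzag' A
  evaluation_coevaluation' := zigzag A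

/-- `Int(pInj)` is compact closed: every object has the dual `A*`. -/
instance : RightRigidCategory IntPInj.{u} where
  rightDual A := { rightDual := dual A }

instance : LeftRigidCategory IntPInj.{u} where
  leftDual A := { leftDual := dual A, exact := exactPairing (dual A) }

instance : RigidCategory IntPInj.{u} where

/-- The monoidal closed structure given by compact closure; the internal hom is
`[A → B] = A* □ B`. -/
instance : MonoidalClosed IntPInj.{u} := monoidalClosedOfLeftRigidCategory _

/-- The internal hom is `[A → B] = A* □ B`. -/
theorem ihom_obj (A B : IntPInj.{u}) : (ihom A).obj B = tensor (dual A) B := rfl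

/-- The object `(ℕ, ℕ)`. -/
abbrev natNat : IntPInj.{0} := ⟨ℕ, ℕ⟩

/-- An object is strictly self-dual when it is equal to its dual. -/
def IsStrictlySelfDual (A : IntPInj.{u}) : Prop := dualFunctor.obj (Opposite.op A) = A

end IntPInj

/-- An object `N` of a monoidal category is self-similar when `N ≅ N ⊗ N`. -/
def IsSelfSimilar {C : Type*} [Category C] [MonoidalCategory C] (N : C) : Prop :=
  Nonempty (N ≅ N ⊗ N)

/-- An object `R` of a monoidal closed category is extensionally reflexive when it is isomorphic to
its own internal hom `[R → R]`. -/
def IsExtensionallyReflexive {C : Type*} [Category C] [MonoidalCategory C] [MonoidalClosed C]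
    (R : C) : Prop :=
  Nonempty ((ihom R).obj R ≅ R)

/-- The Cantor pairing `ℕ ⊎ ℕ → ℕ`, `(n, i) ↦ 2n + i`, with inverse `n ↦ (n/2, 0)` for even `n` and
`n ↦ ((n-1)/2, 1)` for odd `n`. -/
def cantorPairing : ℕ ⊕ ℕ ≃ ℕ where
  toFun
    | .inl n => 2 * n
    | .inr n => 2 * n + 1
  invFun n := if n % 2 = 0 then .inl (n / 2) else .inr ((n - 1) / 2)
  left_inv := by
    rintro (n | n)
    · simp
    · simp [Nat.add_mod]
  right_inv n := by
    rcases Nat.mod_two_eq_zero_or_one n with h | h <;> simp [h] <;> omega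

/-- The code arrow `ℕ ⊎ ℕ → ℕ` of `pInj`: the Cantor pairing. -/
def natCode : PInj (ℕ ⊕ ℕ) ℕ := PInj.ofEquiv cantorPairing

/-- The decode arrow `ℕ → ℕ ⊎ ℕ` of `pInj`: the inverse of the Cantor pairing. -/
def natDecode : PInj ℕ (ℕ ⊕ ℕ) := PInj.ofEquiv cantorPairing.symm

/-! ### Edges of a diagonal rook square. -/

namespace IntPInj

/-! A pair of bijections `X ≃ Y` and `U ≃ V` gives an arrow `(X,U) → (Y,V)` whose rook square
vanishes off the diagonal. When two such squares are glued, a path never turns back at the shared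
edge: it crosses each square exactly once, forwards on the positive wires or backwards on the
negative ones. The union over all paths therefore collapses to componentwise composition
(`diag_comp_diag`), and a pair of bijections is automatically an isomorphism of `Int(pInj)`, with
the pair of inverse bijections as its inverse (`diagIso`).

Self-similarity of `(ℕ, ℕ)` thus needs only a bijection `ℕ ⊎ ℕ ≃ ℕ` used twice, on the positive and
on the negative component. The negative wires run against the direction of the arrow, so the `11`
edge carries the inverse bijection; this is why the code arrow has the Cantor pairing on one
diagonal edge and its inverse on the other, and the decode arrow has them interchanged.

Reflexivity is then formal. Compact closure gives `[A → A] = A* □ A` (`ihom_obj`); strict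
self-duality turns this into `A □ A`, and self-similarity contracts it to `A`. -/

theorem edge00_diag {A B : IntPInj.{u}} (a : A.pos ≃ B.pos) (b : A.neg ≃ B.neg) :
    edge00 (diag a b) = PInj.ofEquiv a :=
  -- The left side unfolds to `Sum.inl (a x) = Sum.inl y`, so the edge is the graph of `a` because
  -- the inclusion of a summand is injective.
  PInj.rel_ext fun _ _ => Sum.inl_injective.eq_iff

/-- A sum of two bijections keeps each wire in its own summand, so nothing entering on the negative
side can leave on the positive side. `edge10_diag` is the mirror case. -/
theorem edge01_diag {A B : IntPInj.{u}} (a : A.pos ≃ B.pos) (b : A.neg ≃ B.neg) :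
    edge01 (diag a b) = PInj.zero B.neg B.pos :=
  PInj.rel_ext fun _ _ => iff_of_false Sum.inr_ne_inl not_false

theorem edge10_diag {A B : IntPInj.{u}} (a : A.pos ≃ B.pos) (b : A.neg ≃ B.neg) :
    edge10 (diag a b) = PInj.zero A.pos A.neg :=
  PInj.rel_ext fun _ _ => iff_of_false Sum.inl_ne_inr not_false

/-- The inverse appears because this edge goes from the negative set of the target back to that of
the source, while `b` goes the other way. -/
theorem edge11_diag {A B : IntPInj.{u}} (a : A.pos ≃ B.pos) (b : A.neg ≃ B.neg) :
    edge11 (diag a b) = PInj.ofEquiv b.symm :=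
  PInj.rel_ext fun _ _ => Sum.inr_injective.eq_iff

/-! ### Self-similarity and extensional reflexivity. -/

/-- The code isomorphism, given on both components by the Cantor pairing. -/
def natNatCode : natNat ⊗ natNat ≅ natNat :=
  -- The tensor reverses the order of the negative components, but here both are `ℕ`, so the same
  -- bijection fits on either side.
  diagIso (A := tensor natNat natNat) (B := natNat) cantorPairing cantorPairing

/-- A strictly self-dual, self-similar object of `Int(pInj)` is extensionally reflexive, since
`[A → A] = A* □ A = A □ A ≅ A`. -/
theorem IsStrictlySelfDual.isExtensionallyReflexive {A : IntPInj.{u}}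
    (hA : IsStrictlySelfDual A) (h : IsSelfSimilar A) : IsExtensionallyReflexive A := by
  obtain ⟨e⟩ := h
  -- The dual functor acts on objects by `dual`, so this is `hA` by unfolding.
  have hdual : dual A = A := hA
  -- Self-duality is an equality of objects, so it can be substituted in the left tensor factor
  -- alone.
  have hhom : (ihom A).obj A = A ⊗ A :=
    (ihom_obj A A).trans (congrArg (fun B => tensor B A) hdual)
  -- `e` points in the decode direction `A ≅ A ⊗ A`; contracting the internal hom to `A` needs its
  -- inverse, the code direction.
  exact ⟨eqToIso hhom ≪≫ e.symm⟩

end IntPInj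

/-! ### The case of `(ℕ, ℕ)`. -/

open IntPInj in
/-- In `Int(pInj)` the object `(ℕ, ℕ)` is strictly self-dual and self-similar.  Self-similarity is
exhibited by the mutually inverse code and decode arrows with the rook squares
`(natCode, 0, 0, natDecode)` and `(natDecode, 0, 0, natCode)`.  Hence `(ℕ, ℕ)` is extensionally
reflexive. -/
theorem mainTheorem8 :
    IsStrictlySelfDual natNat ∧
    IsSelfSimilar natNat ∧
    (∃ e : natNat ⊗ natNat ≅ natNat,
      (edge00 e.hom = natCode ∧ edge01 e.hom = PInj.zero ℕ ℕ ∧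
        edge10 e.hom = PInj.zero (ℕ ⊕ ℕ) (ℕ ⊕ ℕ) ∧ edge11 e.hom = natDecode) ∧
      (edge00 e.inv = natDecode ∧ edge01 e.inv = PInj.zero (ℕ ⊕ ℕ) (ℕ ⊕ ℕ) ∧
        edge10 e.inv = PInj.zero ℕ ℕ ∧ edge11 e.inv = natCode)) ∧
    IsExtensionallyReflexive natNat := by
  -- Exchanging two equal components changes nothing.
  have hdual : IsStrictlySelfDual natNat := rfl
  have hsim : IsSelfSimilar natNat := ⟨natNatCode.symm⟩
  exact ⟨hdual, hsim,
    ⟨natNatCode,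
      ⟨edge00_diag _ _, edge01_diag _ _, edge10_diag _ _, edge11_diag _ _⟩,
      -- The inverse is the diagonal square on `cantorPairing.symm` twice; its `11` edge is the
      -- inverse of that inverse, which is definitionally the pairing itself.
      ⟨edge00_diag _ _, edge01_diag _ _, edge10_diag _ _, edge11_diag _ _⟩⟩,
    hdual.isExtensionallyReflexive hsim⟩
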